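/- Words are elements of $\{0,1\}^n$ with coordinatewise addition modulo $2$, $\bar 1$ is the all-one word, and $d$ is the Hamming distance. A binary $(n,M,d_0)$ code is a set $C\subseteq\{0,1\}^n$ with $|C|=M$ in which the minimum distance between distinct codewords equals $d_0$; for a word $x$ put $d(x,C)=\min_{c\in C}d(x,c)$. For $t\in\{2,3\}$, call $C$ an $(n,3)^{(t)}$ code if, for some positive integer $m$ with $m\le n$, it is an $(n=2^m-1-t,\ 2^{n-m},\ 3)$ code, and an $(n,4)^{(t)}$ code if, for some positive integer $m$ with $m+1\le n$, it is an $(n=2^m-t,\ 2^{n-m-1},\ 4)$ code. We write $(n,3)''$, $(n,3)'''$, $(n,4)''$, $(n,4)'''$ for $(n,3)^{(2)}$, $(n,3)^{(3)}$, $(n,4)^{(2)}$, $(n,4)^{(3)}$. The weight distribution of $C$ with respect to a word $x$ is the tuple $(A_0(x),\dots,A_n(x))$ with $A_l(x)=|\{c\in C: d(x,c)=l\}|$. The code $C$ is distance invariant if its weight distribution with respect to a codeword does not depend on the choice of the codeword; it is completely regular if its weight distribution with respect to a word $x\in\{0,1\}^n$ depends only on $d(x,C)$; it is completely semiregular if its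 weight distribution with respect to a word $x\in\{0,1\}^n$ depends only on $d(x,C)$ and $d(x+\bar 1,C)$. Corollary. (a) Every $(n,3)'''$ code is completely semiregular. Every $(n,4)'''$, $(n,3)''$ or $(n,4)''$ code is completely semiregular and distance invariant. (b) Every self-complementary $(n,3)'''$ code $C$ (that is, $C=C+\bar 1$) is completely regular. -/

import Mathlib

/-- The vertices of the `n`-cube: binary words of length `n`. Addition is coordinatewise
modulo `2`, and `1` is the all-one word. -/
abbrev Word (n : ℕ) : Type := Fin n → ZMod 2

/-- `d` is the minimum distance of the code `C`: the least Hamming distance between two distinct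
codewords (in particular, `C` has at least two codewords). -/
def HasMinDist {n : ℕ} (C : Finset (Word n)) (d : ℕ) : Prop :=
  IsLeast {k : ℕ | ∃ x ∈ C, ∃ y ∈ C, x ≠ y ∧ hammingDist x y = k} d

/-- `C` is an `(n, M, d)` code: length `n`, cardinality `M`, minimum distance `d`. -/
def IsCode {n : ℕ} (C : Finset (Word n)) (M d : ℕ) : Prop :=
  C.card = M ∧ HasMinDist C d

/-- `C` is an `(n = 2 ^ m - 1 - t, 2 ^ (n - m), 3)` code for some `m`: the parameters of a
`t` times shortened `1`-perfect code. -/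
def HasParams3 {n : ℕ} (t : ℕ) (C : Finset (Word n)) : Prop :=
  ∃ m : ℕ, n + 1 + t = 2 ^ m ∧ m ≤ n ∧ IsCode C (2 ^ (n - m)) 3

/-- `C` is an `(n = 2 ^ m - t, 2 ^ (n - m - 1), 4)` code for some `m`: the parameters of a
`t` times shortened extended `1`-perfect code. -/
def HasParams4 {n : ℕ} (t : ℕ) (C : Finset (Word n)) : Prop :=
  ∃ m : ℕ, n + t = 2 ^ m ∧ m + 1 ≤ n ∧ IsCode C (2 ^ (n - (m + 1))) 4

/-- The weight distribution of `C` with respect to the vertex `x`: the tuple whose entry `l`,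
`0 ≤ l ≤ n`, is the number of codewords at distance `l` from `x`. -/
def weightDistribution {n : ℕ} (C : Finset (Word n)) (x : Word n) : Fin (n + 1) → ℕ :=
  fun l => (C.filter fun y => hammingDist x y = (l : ℕ)).card

/-- The distance from the vertex `x` to the code `C` (infinite if `C` is empty). -/
noncomputable def distToCode {n : ℕ} (x : Word n) (C : Finset (Word n)) : ℕ∞ :=
  ⨅ y ∈ C, (hammingDist x y : ℕ∞)

/-- The weight distribution with respect to a codeword does not depend on the codeword. -/
def DistanceInvariant {n : ℕ} (C : Finset (Word n)) : Prop :=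
  ∀ x ∈ C, ∀ y ∈ C, weightDistribution C x = weightDistribution C y

/-- The weight distribution with respect to a vertex `x` depends only on the distance between
`x` and the code. -/
def CompletelyRegular {n : ℕ} (C : Finset (Word n)) : Prop :=
  ∀ x y : Word n, distToCode x C = distToCode y C →
    weightDistribution C x = weightDistribution C y

/-- The weight distribution with respect to a vertex `x` depends only on the distance between
`x` and the code and the distance between `x + 1` and the code. -/
def CompletelySemiregular {n : ℕ} (C : Finset (Word n)) : Prop :=
  ∀ x y : Word n, distToCode x C = distToCode y C →
    distToCode (x + 1) C = distToCode (y + 1) C →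
    weightDistribution C x = weightDistribution C y

/-- `C = C + 1`: the code is closed under complementing all coordinates. -/
def SelfComplementary {n : ℕ} (C : Finset (Word n)) : Prop :=
  C.image (fun x => x + 1) = C

/-! Up to the factor 2^n, the number of codewords at distance l from x is the sum over u of `codeHat
C u * chi u x` times the Krawtchouk value at u, which depends only on the eigenvalue n - 2 wt(u). So
it suffices to know which eigenvalues occur on the support of `codeHat`.

Modulo 4 the eigenvalue is n for even u and n - 2 for odd u. Each parameter family has a polynomial
in the eigenvalue and the parity character that is nonnegative on these classes and whose moment at
every codeword is at most |C| times its value at 0. By `eq_zero_of_codeHat_ne_zero` the support,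
apart from 0 (and 1 if the distance is 4), lies among the zeros: at most two eigenvalues for each
parity.

On such a support any function of the eigenvalue is affine for each parity. The moment of the
interpolant counts only codewords within distance 1 of x and of x + 1, which the two distances
determine: this is semiregularity. For distance 4 the frequency 1 does no harm, because a further
moment shows that all codewords have the same parity. Distance invariance follows by interpolating
all the eigenvalues at once, with degree 2, or degree 3 when the distance is 4. -/

namespace CubeCode

open Finset

/-! ### Characters and eigenvalues of the cube -/

/-- The nontrivial real character of `ZMod 2`. -/
noncomputable def sgn (a : ZMod 2) : ℝ := if a = 0 then 1 else -1

lemma zmod_two_cases (a : ZMod 2) : a = 0 ∨ a = 1 := by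
  revert a; decide

@[simp] lemma sgn_zero : sgn 0 = 1 := by simp [sgn]

@[simp] lemma sgn_one : sgn 1 = -1 := by simp [sgn]

lemma sgn_add (a b : ZMod 2) : sgn (a + b) = sgn a * sgn b := by
  rcases zmod_two_cases a with rfl | rfl <;> rcases zmod_two_cases b with rfl | rfl <;>
    simp [show (1 + 1 : ZMod 2) = 0 from rfl]

/-- The character of the group of words that is indexed by `u`. -/
noncomputable def chi {n : ℕ} (u v : Word n) : ℝ := ∏ i, sgn (u i * v i)

/-- The word with a single one, in position `i`. -/
def unitWord {n : ℕ} (i : Fin n) : Word n := Pi.single i 1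

lemma word_add_self {n : ℕ} (x : Word n) : x + x = 0 := by
  funext i; exact CharTwo.add_self_eq_zero _

lemma chi_add {n : ℕ} (u v w : Word n) : chi u (v + w) = chi u v * chi u w := by
  simp only [chi, ← prod_mul_distrib, Pi.add_apply, mul_add, sgn_add]

@[simp] lemma chi_zero_left {n : ℕ} (v : Word n) : chi 0 v = 1 := by simp [chi]

lemma chi_unitWord {n : ℕ} (u : Word n) (i : Fin n) : chi u (unitWord i) = sgn (u i) := by
  rw [chi, prod_eq_single i]
  · simp [unitWord]
  · intro j _ h; simp [unitWord, Pi.single_eq_of_ne h]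
  · simp

lemma chi_eq_one_or {n : ℕ} (u v : Word n) : chi u v = 1 ∨ chi u v = -1 := by
  have h : chi u v * chi u v = 1 := by
    rw [← chi_add, word_add_self]; simp [chi]
  exact mul_self_eq_one_iff.mp h

lemma sum_chi {n : ℕ} (v : Word n) : ∑ u, chi u v = if v = 0 then 2 ^ n else 0 := by
  have h : ∑ u, chi u v = ∏ i, ∑ a : ZMod 2, sgn (a * v i) := by
    rw [prod_univ_sum, Fintype.piFinset_univ]; rfl
  have h2 : ∀ a : ZMod 2, ∑ b : ZMod 2, sgn (b * a) = 1 + sgn a := fun a => by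
    rw [show (univ : Finset (ZMod 2)) = {0, 1} from rfl, sum_pair (by decide)]; simp
  simp only [h, h2]
  split_ifs with hv
  · subst hv; simp; norm_num
  · obtain ⟨i, hi⟩ := Function.ne_iff.mp hv
    refine prod_eq_zero (mem_univ i) ?_
    rw [(zmod_two_cases (v i)).resolve_left hi]; simp

/-- The eigenvalue of the `n`-cube on the character indexed by `u`. -/
noncomputable def eigen {n : ℕ} (u : Word n) : ℝ := ∑ i, chi u (unitWord i)

lemma sum_sgn {n : ℕ} (u : Word n) : ∑ i, sgn (u i) = n - 2 * hammingNorm u := by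
  have h : ∀ a : ZMod 2, sgn a = 1 - 2 * (if a ≠ 0 then 1 else 0) := fun a => by
    rcases zmod_two_cases a with rfl | rfl <;> simp; norm_num
  simp only [h, sum_sub_distrib, ← mul_sum, sum_boole]
  simp [hammingNorm]

lemma eigen_eq {n : ℕ} (u : Word n) : eigen u = n - 2 * hammingNorm u := by
  simp only [eigen, chi_unitWord, sum_sgn]

lemma chi_one {n : ℕ} (u : Word n) : chi u 1 = (-1) ^ hammingNorm u := by
  simp only [chi, Pi.one_apply, mul_one, sgn, prod_ite, prod_const_one, prod_const, one_mul]
  rfl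

@[simp] lemma eigen_zero {n : ℕ} : eigen (0 : Word n) = n := by simp [eigen]

@[simp] lemma eigen_one {n : ℕ} : eigen (1 : Word n) = -n := by
  simp [eigen, chi_unitWord]

lemma eq_one_of_eigen {n : ℕ} {u : Word n} (h : eigen u = -n) : u = 1 := by
  rw [eigen_eq] at h
  have h1 : hammingNorm u = n := by
    have : (hammingNorm u : ℝ) = n := by linarith
    exact_mod_cast this
  have h2 : univ.filter (fun i => u i ≠ 0) = univ := by
    rw [← card_eq_iff_eq_univ, Fintype.card_fin]; exact h1
  funext i
  exact (zmod_two_cases _).resolve_left (filter_eq_self.mp h2 i (mem_univ i))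

lemma neg_natCast_le_eigen {n : ℕ} (u : Word n) : 0 ≤ eigen u + n := by
  have h : (hammingNorm u : ℝ) ≤ n := by
    exact_mod_cast (hammingNorm_le_card_fintype (x := u)).trans_eq (Fintype.card_fin n)
  rw [eigen_eq]; linarith

/-- The values of the eigenvalue modulo `4`, according to the parity of the weight. -/
lemma eigen_mod_four {n a r : ℕ} (hn : n = 4 * a + r) (u : Word n) :
    ∃ z : ℤ, (eigen u = 4 * z + r ∧ chi u 1 = 1) ∨ (eigen u = 4 * z + r - 2 ∧ chi u 1 = -1) := by
  rw [eigen_eq, chi_one]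
  have hn' : (n : ℝ) = 4 * a + r := by exact_mod_cast hn
  rcases Nat.even_or_odd' (hammingNorm u) with ⟨j, hj | hj⟩
  · refine ⟨a - j, Or.inl ⟨?_, ?_⟩⟩
    · rw [hj, hn']; push_cast; ring
    · rw [hj, pow_mul]; simp
  · refine ⟨a - j, Or.inr ⟨?_, ?_⟩⟩
    · rw [hj, hn']; push_cast; ring
    · rw [hj, pow_succ, pow_mul]; simp

/-! ### Krawtchouk sums over spheres -/

/-- The sum of the character indexed by `u` over the sphere of radius `l`. -/
noncomputable def sphereSum {n : ℕ} (l : ℕ) (u : Word n) : ℝ :=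
  ∑ v ∈ univ.filter (fun v : Word n => hammingNorm v = l), chi u v

-- The sum factors over coordinates, each giving 1 - X or 1 + X: the Krawtchouk generating function.
open Polynomial in
lemma sum_chi_mul_X_pow {n : ℕ} (u : Word n) :
    ∑ v, C (chi u v) * (X : ℝ[X]) ^ hammingNorm v =
      (1 - X) ^ hammingNorm u * (1 + X) ^ (n - hammingNorm u) := by
  have h1 : ∀ v : Word n, C (chi u v) * (X : ℝ[X]) ^ hammingNorm v =
      ∏ i, C (sgn (u i * v i)) * (if v i ≠ 0 then X else 1) := fun v => by
    rw [prod_mul_distrib, chi, map_prod, prod_ite, prod_const, prod_const_one, mul_one]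
    rfl
  have h2 : ∀ a : ZMod 2, ∑ b : ZMod 2, C (sgn (a * b)) * (if b ≠ 0 then (X : ℝ[X]) else 1) =
      if a ≠ 0 then 1 - X else 1 + X := fun a => by
    rw [show (univ : Finset (ZMod 2)) = {0, 1} from rfl, sum_pair (by decide)]
    rcases zmod_two_cases a with rfl | rfl <;> simp
    ring
  have h3 : (univ.filter (fun i => ¬ (u i ≠ 0))).card = n - hammingNorm u := by
    rw [filter_not, ← compl_eq_univ_sdiff, card_compl, Fintype.card_fin]; rfl
  simp only [h1]
  rw [← Fintype.piFinset_univ,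
    ← prod_univ_sum (fun _ => univ) (fun i b => C (sgn (u i * b)) * (if b ≠ 0 then X else 1))]
  simp only [h2, prod_ite, prod_const, h3]
  rfl

open Polynomial in
lemma sphereSum_eq_coeff {n : ℕ} (l : ℕ) (u : Word n) : sphereSum l u =
    ((1 - X) ^ hammingNorm u * (1 + X) ^ (n - hammingNorm u) : ℝ[X]).coeff l := by
  rw [← sum_chi_mul_X_pow, finsetSum_coeff, sphereSum, sum_filter]
  refine sum_congr rfl fun v _ => ?_
  rw [coeff_C_mul, coeff_X_pow]
  simp [eq_comm]

lemma sphereSum_factors {n : ℕ} (l : ℕ) :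
    ∃ φ : ℝ → ℝ, ∀ u : Word n, sphereSum l u = φ (eigen u) := by
  have h : (sphereSum l : Word n → ℝ).FactorsThrough eigen := fun u v huv => by
    have : hammingNorm u = hammingNorm v := by
      rw [eigen_eq, eigen_eq] at huv
      have : (hammingNorm u : ℝ) = hammingNorm v := by linarith
      exact_mod_cast this
    rw [sphereSum_eq_coeff, sphereSum_eq_coeff, this]
  obtain ⟨φ, hφ⟩ := (Function.factorsThrough_iff _).mp h
  exact ⟨φ, fun u => congrFun hφ u⟩

/-! ### Fourier transform, moments and walk counts -/

/-- The Fourier transform of the indicator function of the code. -/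
noncomputable def codeHat {n : ℕ} (C : Finset (Word n)) (u : Word n) : ℝ := ∑ c ∈ C, chi u c

@[simp] lemma codeHat_zero {n : ℕ} (C : Finset (Word n)) : codeHat C 0 = C.card := by
  simp [codeHat]

/-- The indicator function of the code, summed over the endpoints of all walks of length `k` in
the `n`-cube that start at `x`. -/
noncomputable def walkSum {n : ℕ} (C : Finset (Word n)) : ℕ → Word n → ℝ
  | 0, x => if x ∈ C then 1 else 0
  | k + 1, x => ∑ i, walkSum C k (x + unitWord i)

/-- The moment at `x` of the Fourier transform of the code with respect to `q`. -/
noncomputable def moment {n : ℕ} (C : Finset (Word n)) (x : Word n) (q : Word n → ℝ) : ℝ :=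
  ∑ u, codeHat C u * chi u x * q u

lemma moment_add {n : ℕ} (C : Finset (Word n)) (x : Word n) (p q : Word n → ℝ) :
    moment C x (fun u => p u + q u) = moment C x p + moment C x q := by
  simp only [moment, mul_add, sum_add_distrib]

lemma moment_const_mul {n : ℕ} (C : Finset (Word n)) (x : Word n) (a : ℝ) (q : Word n → ℝ) :
    moment C x (fun u => a * q u) = a * moment C x q := by
  simp only [moment, mul_sum]
  exact sum_congr rfl fun u _ => by ring

/-- Taking v = 1, the parity character moves the base point to x + 1; this is how the distance from
x + 1 enters. -/
lemma moment_chi {n : ℕ} (C : Finset (Word n)) (x v : Word n) (q : Word n → ℝ) :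
    moment C x (fun u => chi u v * q u) = moment C (x + v) q := by
  simp only [moment, chi_add]
  exact sum_congr rfl fun u _ => by ring

/-- Characters are eigenfunctions of the adjacency operator of the cube. -/
lemma moment_eigen {n : ℕ} (C : Finset (Word n)) (x : Word n) (q : Word n → ℝ) :
    moment C x (fun u => eigen u * q u) = ∑ i, moment C (x + unitWord i) q := by
  simp only [moment, chi_add, eigen]
  rw [sum_comm]
  refine sum_congr rfl fun u _ => ?_
  rw [sum_mul, mul_sum]
  exact sum_congr rfl fun u _ => by ring

lemma neg_word {n : ℕ} (x : Word n) : -x = x :=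
  neg_eq_of_add_eq_zero_left (word_add_self x)

lemma add_eq_zero_iff_word {n : ℕ} (x y : Word n) : x + y = 0 ↔ x = y := by
  rw [add_eq_zero_iff_eq_neg, neg_word]

lemma moment_one {n : ℕ} (C : Finset (Word n)) (x : Word n) :
    moment C x (fun _ => 1) = 2 ^ n * walkSum C 0 x := by
  simp only [moment, codeHat, mul_one, sum_mul, ← chi_add]
  rw [sum_comm]
  simp only [sum_chi, add_eq_zero_iff_word, walkSum]
  rw [sum_ite_eq']
  simp

lemma moment_eigen_pow {n : ℕ} (C : Finset (Word n)) (x : Word n) (k : ℕ) :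
    moment C x (fun u => eigen u ^ k) = 2 ^ n * walkSum C k x := by
  induction k generalizing x with
  | zero => simp only [pow_zero]; exact moment_one C x
  | succ k ih => simp only [pow_succ', moment_eigen, ih, walkSum, mul_sum]

lemma moment_combination {n : ℕ} (C : Finset (Word n)) (x : Word n) (a b c d e f g : ℝ) :
    moment C x (fun u => a + b * eigen u + c * eigen u ^ 2 + d * eigen u ^ 3 +
      chi u 1 * (e + f * eigen u + g * eigen u ^ 2)) =
    2 ^ n * (a * walkSum C 0 x + b * walkSum C 1 x + c * walkSum C 2 x + d * walkSum C 3 x +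
      (e * walkSum C 0 (x + 1) + f * walkSum C 1 (x + 1) + g * walkSum C 2 (x + 1))) := by
  have h : ∀ (y : Word n) (a b c d : ℝ), moment C y (fun u => a + b * eigen u + c * eigen u ^ 2 +
      d * eigen u ^ 3) = 2 ^ n * (a * walkSum C 0 y + b * walkSum C 1 y + c * walkSum C 2 y +
        d * walkSum C 3 y) := fun y a b c d => by
    have h0 : ∀ u : Word n, a + b * eigen u + c * eigen u ^ 2 + d * eigen u ^ 3 =
      ((a * eigen u ^ 0 + b * eigen u ^ 1) + c * eigen u ^ 2) + d * eigen u ^ 3 := fun u => by ring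
    simp only [h0]
    rw [moment_add, moment_add, moment_add]
    simp only [moment_const_mul, moment_eigen_pow]
    ring
  rw [moment_add, moment_chi, h]
  have := h (x + 1) e f g 0
  simp only [zero_mul, add_zero] at this
  rw [this]; ring

/-! ### Linear programming and weight distributions -/

lemma sum_codeHat_sq_mul {n : ℕ} (C : Finset (Word n)) (q : Word n → ℝ) :
    ∑ u, codeHat C u ^ 2 * q u = ∑ c ∈ C, moment C c q := by
  simp only [moment]
  rw [sum_comm]
  refine sum_congr rfl fun u _ => ?_
  rw [← sum_mul, ← mul_sum, sq]
  rfl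

/-- The linear programming argument: a nonnegative `q` with large value at `0` has to vanish on
the rest of the support of the Fourier transform. -/
lemma eq_zero_of_codeHat_ne_zero {n : ℕ} {C : Finset (Word n)} {q : Word n → ℝ} (hq : ∀ u, 0 ≤ q u)
    (h : ∀ c ∈ C, moment C c q ≤ C.card * q 0) {u : Word n} (hu : u ≠ 0) (hS : codeHat C u ≠ 0) :
    q u = 0 := by
  have h1 : ∑ u, codeHat C u ^ 2 * q u ≤ codeHat C 0 ^ 2 * q 0 := by
    rw [sum_codeHat_sq_mul, codeHat_zero]
    refine (sum_le_card_nsmul _ _ _ h).trans_eq ?_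
    rw [nsmul_eq_mul]; ring
  rw [← add_sum_erase _ _ (mem_univ (0 : Word n))] at h1
  have h2 : ∀ v ∈ univ.erase (0 : Word n), 0 ≤ codeHat C v ^ 2 * q v :=
    fun v _ => mul_nonneg (sq_nonneg _) (hq v)
  have h3 := (sum_eq_zero_iff_of_nonneg h2).mp (le_antisymm (by linarith) (sum_nonneg h2)) u
    (mem_erase.mpr ⟨hu, mem_univ u⟩)
  exact (mul_eq_zero.mp h3).resolve_left (pow_ne_zero 2 hS)

lemma weightDistribution_eq_moment {n : ℕ} (C : Finset (Word n)) (x : Word n) (l : Fin (n + 1)) :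
    (2 : ℝ) ^ n * weightDistribution C x l = moment C x (sphereSum l) := by
  have h1 : moment C x (sphereSum l) =
      ∑ v ∈ univ.filter (fun v : Word n => hammingNorm v = l), 2 ^ n * walkSum C 0 (x + v) := by
    simp only [← moment_one, ← moment_chi, mul_one]
    simp only [moment, sphereSum, mul_sum]
    rw [sum_comm]
  rw [h1, ← mul_sum]
  congr 1
  simp only [walkSum, sum_boole, weightDistribution, filter_filter]
  norm_cast
  refine card_bij' (fun y _ => x - y) (fun v _ => x - v) ?_ ?_ ?_ ?_
  · intro y hy
    rw [mem_filter] at hy ⊢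
    refine ⟨mem_univ _, by rw [← hy.2, hammingDist_eq_hammingNorm, sub_eq_add_neg, neg_word, neg_word], ?_⟩
    rw [add_sub_assoc', word_add_self, zero_sub, neg_word]
    exact hy.1
  · intro v hv
    rw [mem_filter] at hv ⊢
    rw [sub_eq_add_neg, neg_word]
    refine ⟨hv.2.2, ?_⟩
    rw [hammingDist_eq_hammingNorm, neg_add_cancel_left]
    exact hv.2.1
  · intros; simp
  · intros; simp

lemma weightDistribution_congr {n : ℕ} {C : Finset (Word n)} {x y : Word n}
    (h : ∀ φ : ℝ → ℝ, moment C x (fun u => φ (eigen u)) = moment C y (fun u => φ (eigen u))) :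
    weightDistribution C x = weightDistribution C y := by
  funext l
  obtain ⟨φ, hφ⟩ := sphereSum_factors (n := n) l
  have h1 := weightDistribution_eq_moment C x l
  have h2 := weightDistribution_eq_moment C y l
  rw [show (sphereSum l : Word n → ℝ) = fun u => φ (eigen u) from funext hφ] at h1 h2
  have h3 : (2 : ℝ) ^ n * weightDistribution C x l = 2 ^ n * weightDistribution C y l := by
    rw [h1, h2, h]
  exact_mod_cast mul_left_cancel₀ (by positivity) h3

/-- Moments at two words agree if the test functions agree with a test function with equal moments
on the part of the support of the Fourier transform that separates the two words. -/
lemma moment_eq_of_agree {n : ℕ} {C : Finset (Word n)} {x y : Word n} {p q : Word n → ℝ}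
    (hq : moment C x q = moment C y q)
    (h : ∀ u, codeHat C u ≠ 0 → chi u x ≠ chi u y → p u = q u) :
    moment C x p = moment C y p := by
  have h1 : moment C x p - moment C y p = moment C x q - moment C y q := by
    simp only [moment, ← sum_sub_distrib]
    refine sum_congr rfl fun u _ => ?_
    by_cases h0 : codeHat C u = 0
    · simp [h0]
    by_cases h2 : chi u x = chi u y
    · simp [h2]
    · rw [h u h0 h2]
  linarith

/-! ### Codewords near a given word -/

/-- Distinct codewords are at distance at least `d`. -/
def Separated {n : ℕ} (d : ℕ) (C : Finset (Word n)) : Prop :=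
  ∀ x ∈ C, ∀ y ∈ C, x ≠ y → d ≤ hammingDist x y

lemma Separated.eq {n d : ℕ} {C : Finset (Word n)} (h : Separated d C) {x y : Word n}
    (hx : x ∈ C) (hy : y ∈ C) (hd : hammingDist x y < d) : x = y := by
  by_contra hne
  exact absurd (h x hx y hy hne) (by omega)

lemma Separated.mono {n d e : ℕ} {C : Finset (Word n)} (h : Separated d C) (he : e ≤ d) :
    Separated e C := fun x hx y hy hne => he.trans (h x hx y hy hne)

lemma hammingDist_add_unitWord {n : ℕ} (x : Word n) (i : Fin n) :
    hammingDist x (x + unitWord i) = 1 := by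
  rw [hammingDist_eq_hammingNorm, neg_add_cancel_left]
  simp [hammingNorm, unitWord, Pi.single_apply, filter_eq']

lemma unitWord_injective {n : ℕ} : Function.Injective (unitWord : Fin n → Word n) := by
  intro i j h
  by_contra hne
  have := congrFun h i
  simp [unitWord, hne] at this

lemma walkSum_zero_nonneg {n : ℕ} (C : Finset (Word n)) (x : Word n) : 0 ≤ walkSum C 0 x := by
  simp only [walkSum]; split_ifs <;> norm_num

lemma walkSum_zero_le_one {n : ℕ} (C : Finset (Word n)) (x : Word n) : walkSum C 0 x ≤ 1 := by
  simp only [walkSum]; split_ifs <;> norm_num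

lemma walkSum_one_eq_card {n : ℕ} (C : Finset (Word n)) (x : Word n) :
    walkSum C 1 x = (univ.filter fun i => x + unitWord i ∈ C).card := by
  simp only [walkSum, sum_boole]

lemma walkSum_one_eq_zero {n : ℕ} {C : Finset (Word n)} {x : Word n}
    (h : ∀ i, x + unitWord i ∉ C) : walkSum C 1 x = 0 := by
  simp [walkSum, h]

lemma walkSum_one_le_one {n : ℕ} {C : Finset (Word n)} (h : Separated 3 C) (x : Word n) :
    walkSum C 1 x ≤ 1 := by
  rw [walkSum_one_eq_card]
  have : (univ.filter fun i => x + unitWord i ∈ C).card ≤ 1 := by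
    refine card_le_one.mpr fun i hi j hj => ?_
    simp only [mem_filter, mem_univ, true_and] at hi hj
    refine unitWord_injective (add_left_cancel (h.eq hi hj ?_))
    have := hammingDist_triangle_left (x + unitWord i) (x + unitWord j) x
    rw [hammingDist_add_unitWord, hammingDist_add_unitWord] at this
    omega
  exact_mod_cast this

lemma walkSum_one_of_mem {n : ℕ} {C : Finset (Word n)} (h : Separated 3 C) {x : Word n}
    (hx : x ∈ C) : walkSum C 1 x = 0 := by
  refine walkSum_one_eq_zero fun i hi => ?_
  have h1 := hammingDist_add_unitWord x i
  have := h.eq hx hi (by omega)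
  rw [← this, hammingDist_self] at h1
  omega

lemma walkSum_zero_add_one_le {n : ℕ} {C : Finset (Word n)} (h : Separated 3 C) (x : Word n) :
    walkSum C 0 x + walkSum C 1 x ≤ 1 := by
  by_cases hx : x ∈ C
  · rw [walkSum_one_of_mem h hx]; simp [walkSum, hx]
  · have := walkSum_one_le_one h x
    simpa [walkSum, hx] using this

lemma walkSum_one_of_exists {n : ℕ} {C : Finset (Word n)} (h : Separated 3 C) {x : Word n}
    {i : Fin n} (hx : x + unitWord i ∈ C) : walkSum C 1 x = 1 := by
  refine le_antisymm (walkSum_one_le_one h x) ?_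
  rw [walkSum_one_eq_card]
  exact_mod_cast card_pos.mpr ⟨i, by simpa using hx⟩

lemma add_add_cancel_word {n : ℕ} (x y : Word n) : x + y + y = x := by
  rw [add_assoc, word_add_self, add_zero]

lemma walkSum_two_of_mem {n : ℕ} {C : Finset (Word n)} (h : Separated 3 C) {x : Word n}
    (hx : x ∈ C) : walkSum C 2 x = n := by
  have : ∀ i, walkSum C 1 (x + unitWord i) = 1 := fun i =>
    walkSum_one_of_exists h (i := i) (by rwa [add_add_cancel_word])
  rw [walkSum]; simp [this]

lemma chi_one_unitWord {n : ℕ} (i : Fin n) : chi 1 (unitWord i) = -1 := by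
  rw [chi_unitWord]; simp

/-- Codeword neighbours of x and of x + e_i would be within distance 3, hence equal, yet they have
opposite parities. -/
lemma walkSum_one_add_le {n : ℕ} {C : Finset (Word n)} (h : Separated 4 C) (x : Word n)
    (i : Fin n) : walkSum C 1 (x + unitWord i) + walkSum C 1 x ≤ 1 := by
  have h3 : Separated 3 C := h.mono (by norm_num)
  by_cases hx : ∃ k, x + unitWord k ∈ C
  · obtain ⟨k, hk⟩ := hx
    rw [walkSum_one_of_exists h3 hk, walkSum_one_eq_zero, zero_add]
    intro j hj
    have e1 := hammingDist_triangle (x + unitWord k) x (x + unitWord i + unitWord j)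
    have e2 := hammingDist_triangle x (x + unitWord i) (x + unitWord i + unitWord j)
    rw [hammingDist_add_unitWord, hammingDist_add_unitWord] at e2
    rw [hammingDist_comm (x + unitWord k) x, hammingDist_add_unitWord] at e1
    have := congrArg (chi 1) (h.eq hk hj (by omega))
    simp only [chi_add, chi_one_unitWord] at this
    rcases chi_eq_one_or 1 x with h1 | h1 <;> rw [h1] at this <;> norm_num at this
  · push Not at hx
    rw [walkSum_one_eq_zero hx, add_zero]
    exact walkSum_one_le_one h3 _

lemma walkSum_three_of_mem {n : ℕ} {C : Finset (Word n)} (h : Separated 4 C) {x : Word n}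
    (hx : x ∈ C) : walkSum C 3 x = 0 := by
  have h1 : ∀ i j, walkSum C 1 (x + unitWord i + unitWord j) = 0 := fun i j => by
    have e1 := walkSum_one_add_le h (x + unitWord i) j
    have e2 : walkSum C 1 (x + unitWord i) = 1 :=
      walkSum_one_of_exists (h.mono (by norm_num)) (i := i) (by rwa [add_add_cancel_word])
    refine le_antisymm (by linarith) ?_
    rw [walkSum_one_eq_card]; positivity
  rw [walkSum]
  refine sum_eq_zero fun i _ => ?_
  rw [walkSum]
  exact sum_eq_zero fun j _ => h1 i j

lemma walkSum_two_add_le {n : ℕ} {C : Finset (Word n)} (h : Separated 4 C) (x : Word n) :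
    walkSum C 2 x + n * walkSum C 1 x ≤ n := by
  have h1 : walkSum C 2 x + n * walkSum C 1 x =
      ∑ i, (walkSum C 1 (x + unitWord i) + walkSum C 1 x) := by
    rw [sum_add_distrib, walkSum]; simp
  rw [h1]
  refine (sum_le_card_nsmul _ _ 1 fun i _ => walkSum_one_add_le h x i).trans_eq ?_
  simp

/-! ### Distance to the code and parity -/

lemma exists_distToCode_eq {n : ℕ} {C : Finset (Word n)} (hC : C.Nonempty) (x : Word n) :
    ∃ c ∈ C, distToCode x C = hammingDist x c := by
  obtain ⟨c, hc, h⟩ := exists_min_image C (fun y => hammingDist x y) hC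
  exact ⟨c, hc, le_antisymm (iInf₂_le c hc) (le_iInf₂ fun y hy => by exact_mod_cast h y hy)⟩

lemma distToCode_le_iff {n : ℕ} {C : Finset (Word n)} (hC : C.Nonempty) (x : Word n) (k : ℕ) :
    distToCode x C ≤ k ↔ ∃ c ∈ C, hammingDist x c ≤ k := by
  constructor
  · intro h
    obtain ⟨c, hc, hd⟩ := exists_distToCode_eq hC x
    rw [hd] at h
    exact ⟨c, hc, by exact_mod_cast h⟩
  · rintro ⟨c, hc, hd⟩
    exact (iInf₂_le c hc).trans (by exact_mod_cast hd)

lemma eq_or_eq_add_unitWord {n : ℕ} {x y : Word n} (h : hammingDist x y ≤ 1) :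
    y = x ∨ ∃ i, y = x + unitWord i := by
  rcases Nat.le_one_iff_eq_zero_or_eq_one.mp h with h | h
  · exact Or.inl (hammingDist_eq_zero.mp h).symm
  · obtain ⟨i, hi⟩ := card_eq_one.mp h
    refine Or.inr ⟨i, ?_⟩
    funext j
    have hj : x j ≠ y j ↔ j = i := by
      have := congrArg (j ∈ ·) hi
      simpa using this
    simp only [Pi.add_apply, unitWord, Pi.single_apply]
    by_cases hji : j = i
    · have := hj.mpr hji
      rw [if_pos hji]
      revert this
      generalize x j = a
      generalize y j = b
      revert a b; decide
    · rw [if_neg hji, add_zero]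
      by_contra hne
      exact hji (hj.mp (Ne.symm hne))

lemma walkSum_zero_eq {n : ℕ} {C : Finset (Word n)} (hC : C.Nonempty) (x : Word n) :
    walkSum C 0 x = if distToCode x C ≤ (0 : ℕ) then 1 else 0 := by
  have : x ∈ C ↔ distToCode x C ≤ (0 : ℕ) := by
    rw [distToCode_le_iff hC]
    constructor
    · exact fun h => ⟨x, h, by simp⟩
    · rintro ⟨c, hc, h⟩
      rwa [hammingDist_eq_zero.mp (Nat.le_zero.mp h)]
  simp only [walkSum, this]

lemma walkSum_zero_add_one_eq {n : ℕ} {C : Finset (Word n)} (hC : C.Nonempty) (h : Separated 3 C)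
    (x : Word n) : walkSum C 0 x + walkSum C 1 x = if distToCode x C ≤ (1 : ℕ) then 1 else 0 := by
  split_ifs with hd
  · obtain ⟨c, hc, hd⟩ := (distToCode_le_iff hC x 1).mp hd
    rcases eq_or_eq_add_unitWord hd with rfl | ⟨i, rfl⟩
    · rw [walkSum_one_of_mem h hc]; simp [walkSum, hc]
    · have h1 := walkSum_one_of_exists h hc
      have h2 := walkSum_zero_add_one_le h x
      have h3 := walkSum_zero_nonneg C x
      linarith
  · rw [distToCode_le_iff hC] at hd
    push Not at hd
    have hx : x ∉ C := fun hx => by simpa using hd x hx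
    rw [walkSum_one_eq_zero fun i hi => ?_]
    · simp [walkSum, hx]
    · have := hd _ hi
      rw [hammingDist_add_unitWord] at this
      omega

lemma chi_comm {n : ℕ} (u v : Word n) : chi u v = chi v u := by
  simp only [chi, mul_comm]

/-- The distances between codewords are even. -/
def EvenDistances {n : ℕ} (C : Finset (Word n)) : Prop :=
  ∀ x ∈ C, ∀ y ∈ C, chi 1 x = chi 1 y

lemma chi_one_eq_mul {n : ℕ} (x c : Word n) : chi 1 x = (-1) ^ hammingDist x c * chi 1 c := by
  have h1 : x = x + c + c := (add_add_cancel_word x c).symm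
  have h2 : hammingDist x c = hammingNorm (x + c) := by
    rw [hammingDist_eq_hammingNorm, neg_word]
  rw [h2, ← chi_one, chi_comm (x + c), ← chi_add, ← h1]

/-- The parity of x is that of its distance to the code plus the common parity of the codewords.
Hence the frequency 1 cannot separate x from y. -/
lemma chi_one_eq_of_distToCode_eq {n : ℕ} {C : Finset (Word n)} (hC : C.Nonempty)
    (h : EvenDistances C) {x y : Word n} (hxy : distToCode x C = distToCode y C) :
    chi 1 x = chi 1 y := by
  obtain ⟨c, hc, hd⟩ := exists_distToCode_eq hC x
  obtain ⟨c', hc', hd'⟩ := exists_distToCode_eq hC y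
  have : hammingDist x c = hammingDist y c' := by
    rw [hd, hd'] at hxy; exact_mod_cast hxy
  rw [chi_one_eq_mul x c, chi_one_eq_mul y c', h c hc c' hc', this]

/-! ### From spectral support to regularity -/

lemma exists_affine_interpolation (φ : ℝ → ℝ) (p q : ℝ) :
    ∃ s t : ℝ, φ p = s + t * p ∧ φ q = s + t * q := by
  by_cases h : p = q
  · subst h; exact ⟨φ p, 0, by ring, by ring⟩
  · have h' : p - q ≠ 0 := sub_ne_zero.mpr h
    refine ⟨φ p - (φ p - φ q) / (p - q) * p, (φ p - φ q) / (p - q), by ring, ?_⟩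
    field_simp; ring

/-- The Fourier transform of the code is supported on `0`, on `1` if all distances are even, and
on words that satisfy `P`. -/
def SupportedOn {n : ℕ} (C : Finset (Word n)) (P : Word n → Prop) : Prop :=
  ∀ u, codeHat C u ≠ 0 → u ≠ 0 → (u = 1 ∧ EvenDistances C) ∨ P u

/-- `u` has even weight and eigenvalue `p` or `q`, or odd weight and eigenvalue `r` or `s`. -/
def EigenIn {n : ℕ} (p q r s : ℝ) (u : Word n) : Prop :=
  (chi u 1 = 1 ∧ (eigen u = p ∨ eigen u = q)) ∨ (chi u 1 = -1 ∧ (eigen u = r ∨ eigen u = s))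

theorem completelySemiregular_of_supportedOn {n : ℕ} {C : Finset (Word n)} (hC : C.Nonempty)
    (h3 : Separated 3 C) {p q r s : ℝ} (hS : SupportedOn C (EigenIn p q r s)) :
    CompletelySemiregular C := by
  intro x y hxy hxy'
  refine weightDistribution_congr fun φ => ?_
  obtain ⟨a, b, h1, h2⟩ := exists_affine_interpolation φ p q
  obtain ⟨a', b', h1', h2'⟩ := exists_affine_interpolation φ r s
  have e0 : ∀ z w, distToCode z C = distToCode w C → walkSum C 0 z = walkSum C 0 w :=
    fun z w h => by rw [walkSum_zero_eq hC, walkSum_zero_eq hC, h]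
  have e1 : ∀ z w, distToCode z C = distToCode w C → walkSum C 1 z = walkSum C 1 w :=
    fun z w h => by
      have e := walkSum_zero_add_one_eq hC h3 z
      rw [h, ← walkSum_zero_add_one_eq hC h3 w, e0 z w h] at e
      linarith
  -- The projections (1 ± chi u 1) / 2 glue a + b * eigen on even words to a' + b' * eigen on odd
  -- words.
  refine moment_eq_of_agree (q := fun u => (a + a') / 2 + (b + b') / 2 * eigen u +
    0 * eigen u ^ 2 + 0 * eigen u ^ 3 +
    chi u 1 * ((a - a') / 2 + (b - b') / 2 * eigen u + 0 * eigen u ^ 2)) ?_ fun u hu huxy => ?_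
  · rw [moment_combination, moment_combination, e0 x y hxy, e1 x y hxy, e0 _ _ hxy', e1 _ _ hxy']
    ring
  · have hu0 : u ≠ 0 := by rintro rfl; simp at huxy
    rcases hS u hu hu0 with ⟨rfl, he⟩ | ⟨h, he | he⟩ | ⟨h, he | he⟩
    · exact absurd (chi_one_eq_of_distToCode_eq hC he hxy) huxy
    · rw [h, he, h1]; ring
    · rw [h, he, h2]; ring
    · rw [h, he, h1']; ring
    · rw [h, he, h2']; ring

/-- From a codeword, the walks of length at most 2 that end in the code number 1, 0 and n; those of
length 3 number 0 when the distance is at least 4. -/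
theorem distanceInvariant_of_supportedOn {n : ℕ} {C : Finset (Word n)} (h3 : Separated 3 C)
    {P : Word n → Prop} (hS : SupportedOn C P)
    (hP : ∀ φ : ℝ → ℝ, ∃ a b c d : ℝ, (d = 0 ∨ Separated 4 C) ∧ ∀ u, P u →
      φ (eigen u) = a + b * eigen u + c * eigen u ^ 2 + d * eigen u ^ 3) :
    DistanceInvariant C := by
  intro x hx y hy
  refine weightDistribution_congr fun φ => ?_
  obtain ⟨a, b, c, d, hd, h⟩ := hP φ
  refine moment_eq_of_agree (q := fun u => a + b * eigen u + c * eigen u ^ 2 + d * eigen u ^ 3 +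
    chi u 1 * (0 + 0 * eigen u + 0 * eigen u ^ 2)) ?_ fun u hu huxy => ?_
  · rw [moment_combination, moment_combination, walkSum_one_of_mem h3 hx,
      walkSum_one_of_mem h3 hy, walkSum_two_of_mem h3 hx, walkSum_two_of_mem h3 hy]
    have : d * walkSum C 3 x = d * walkSum C 3 y := by
      rcases hd with rfl | h4
      · simp
      · rw [walkSum_three_of_mem h4 hx, walkSum_three_of_mem h4 hy]
    rw [this]
    simp [walkSum, hx, hy]
  · have hu0 : u ≠ 0 := by rintro rfl; simp at huxy
    rcases hS u hu hu0 with ⟨rfl, he⟩ | hu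
    · exact absurd (he x hx y hy) huxy
    · simp only [h u hu]; ring

/-! ### Fourier support of the four families -/

lemma mul_add_one_nonneg (z : ℤ) : (0 : ℝ) ≤ z * (z + 1) := by
  have : 0 ≤ z * (z + 1) := by
    rcases le_or_gt 0 z with h | h
    · positivity
    · nlinarith
  exact_mod_cast this

lemma eq_zero_or_of_mul_add_one {z : ℤ} (h : (z : ℝ) * (z + 1) = 0) :
    (z : ℝ) = 0 ∨ (z : ℝ) = -1 := by
  rcases mul_eq_zero.mp h with h | h
  · exact Or.inl h
  · exact Or.inr (by linarith)

lemma mul_sub_one_nonneg (z : ℤ) : (0 : ℝ) ≤ z * (z - 1) := by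
  have := mul_add_one_nonneg (z - 1)
  push_cast at this; linarith

lemma eq_zero_or_of_mul_sub_one {z : ℤ} (h : (z : ℝ) * (z - 1) = 0) :
    (z : ℝ) = 0 ∨ (z : ℝ) = 1 := by
  rcases mul_eq_zero.mp h with h | h
  · exact Or.inl h
  · exact Or.inr (by linarith)

lemma walkSum_zero_of_mem {n : ℕ} {C : Finset (Word n)} {x : Word n} (hx : x ∈ C) :
    walkSum C 0 x = 1 := by simp [walkSum, hx]

/-- With e the eigenvalue, the test function is e(e + 4) = 16z(z + 1) on even words (e = 4z) and e²
- 4 = 16z(z - 1) on odd words (e = 4z - 2). -/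
theorem codeHat_support_triply_shortened {n a : ℕ} {C : Finset (Word n)} (h3 : Separated 3 C)
    (hn : n = 4 * a) (hcard : ((n : ℝ) + 4) * C.card = 2 ^ n) {u : Word n}
    (hS : codeHat C u ≠ 0) (hu : u ≠ 0) : EigenIn 0 (-4) 2 (-2) u := by
  have hq := eq_zero_of_codeHat_ne_zero (C := C) (q := fun u => (-2) + 2 * eigen u +
    1 * eigen u ^ 2 + 0 * eigen u ^ 3 + chi u 1 * (2 + 2 * eigen u + 0 * eigen u ^ 2)) ?_ ?_ hu hS
  · obtain ⟨z, ⟨h, he⟩ | ⟨h, he⟩⟩ := eigen_mod_four (r := 0) hn u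
    · simp only [h, he] at hq
      rcases eq_zero_or_of_mul_add_one (z := z) (by push_cast at hq; linarith) with hz | hz <;>
        rw [hz] at h
      · exact Or.inl ⟨he, Or.inl (by rw [h]; norm_num)⟩
      · exact Or.inl ⟨he, Or.inr (by rw [h]; norm_num)⟩
    · simp only [h, he] at hq
      rcases eq_zero_or_of_mul_sub_one (z := z) (by push_cast at hq; linarith) with hz | hz <;>
        rw [hz] at h
      · exact Or.inr ⟨he, Or.inr (by rw [h]; norm_num)⟩
      · exact Or.inr ⟨he, Or.inl (by rw [h]; norm_num)⟩
  · intro v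
    obtain ⟨z, ⟨h, he⟩ | ⟨h, he⟩⟩ := eigen_mod_four (r := 0) hn v
    · simp only [h, he]
      have := mul_add_one_nonneg z
      push_cast; linarith
    · simp only [h, he]
      have := mul_sub_one_nonneg z
      push_cast; linarith
  · intro c hc
    rw [moment_combination, walkSum_zero_of_mem hc, walkSum_one_of_mem h3 hc,
      walkSum_two_of_mem h3 hc, ← hcard, eigen_zero, chi_zero_left]
    have h1 := walkSum_zero_add_one_le h3 (c + 1)
    calc _ = ((n : ℝ) + 4) * C.card * (n - 2 + 2 * (walkSum C 0 (c + 1) + walkSum C 1 (c + 1))) := by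
          ring
      _ ≤ ((n : ℝ) + 4) * C.card * (n - 2 + 2 * 1) := by gcongr
      _ = _ := by ring

/-- The test function is (e - 1)(e + 3) on even words and (e + 1)² on odd words. -/
theorem codeHat_support_doubly_shortened {n a : ℕ} {C : Finset (Word n)} (h3 : Separated 3 C)
    (hn : n = 4 * a + 1) (hcard : ((n : ℝ) + 3) * C.card = 2 ^ n) {u : Word n}
    (hS : codeHat C u ≠ 0) (hu : u ≠ 0) : EigenIn 1 (-3) (-1) (-1) u := by
  have hq := eq_zero_of_codeHat_ne_zero (C := C) (q := fun u => (-1) + 2 * eigen u +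
    1 * eigen u ^ 2 + 0 * eigen u ^ 3 + chi u 1 * ((-2) + 0 * eigen u + 0 * eigen u ^ 2)) ?_ ?_
    hu hS
  · obtain ⟨z, ⟨h, he⟩ | ⟨h, he⟩⟩ := eigen_mod_four (r := 1) hn u
    · simp only [h, he] at hq
      rcases eq_zero_or_of_mul_add_one (z := z) (by push_cast at hq; linarith) with hz | hz <;>
        rw [hz] at h
      · exact Or.inl ⟨he, Or.inl (by rw [h]; norm_num)⟩
      · exact Or.inl ⟨he, Or.inr (by rw [h]; norm_num)⟩
    · simp only [h, he] at hq
      have hz : (z : ℝ) = 0 := pow_eq_zero_iff (two_ne_zero) |>.mp (by push_cast at hq; linarith)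
      rw [hz] at h
      exact Or.inr ⟨he, Or.inl (by rw [h]; norm_num)⟩
  · intro v
    obtain ⟨z, ⟨h, he⟩ | ⟨h, he⟩⟩ := eigen_mod_four (r := 1) hn v
    · simp only [h, he]
      have := mul_add_one_nonneg z
      push_cast; linarith
    · simp only [h, he]
      have := sq_nonneg (z : ℝ)
      push_cast; linarith
  · intro c hc
    rw [moment_combination, walkSum_zero_of_mem hc, walkSum_one_of_mem h3 hc,
      walkSum_two_of_mem h3 hc, ← hcard, eigen_zero, chi_zero_left]
    have h1 := walkSum_zero_nonneg C (c + 1)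
    calc _ = ((n : ℝ) + 3) * C.card * (n - 1 - 2 * walkSum C 0 (c + 1)) := by ring
      _ ≤ ((n : ℝ) + 3) * C.card * (n - 1 - 2 * 0) := by gcongr
      _ = _ := by ring

theorem codeHat_support_triply_shortened_extended {n a : ℕ} {C : Finset (Word n)}
    (h4 : Separated 4 C) (hn : n = 4 * a + 1) (hcard : 2 * ((n : ℝ) + 3) * C.card = 2 ^ n)
    {u : Word n} (hS : codeHat C u ≠ 0) (hu : u ≠ 0) : u = 1 ∨ EigenIn 1 (-3) (-1) 3 u := by
  have h3 : Separated 3 C := h4.mono (by norm_num)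
  -- The factor eigen + n is nonnegative and vanishes only at u = 1. The other factor is (e - 1)(e +
  -- 3) on even words and (e + 1)(e - 3) on odd words.
  have hform : ∀ v : Word n, (-3 * n) + (-3) * eigen v + n * eigen v ^ 2 + 1 * eigen v ^ 3 +
      chi v 1 * (0 + 2 * n * eigen v + 2 * eigen v ^ 2) =
      (eigen v + n) * (eigen v ^ 2 - 3 + 2 * chi v 1 * eigen v) := fun v => by ring
  have hq := eq_zero_of_codeHat_ne_zero (C := C) (q := fun v => (-3 * n) + (-3) * eigen v +
    n * eigen v ^ 2 + 1 * eigen v ^ 3 + chi v 1 * (0 + 2 * n * eigen v + 2 * eigen v ^ 2)) ?_ ?_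
    hu hS
  · simp only [hform] at hq
    rcases mul_eq_zero.mp hq with hq | hq
    · exact Or.inl (eq_one_of_eigen (by linarith))
    right
    obtain ⟨z, ⟨h, he⟩ | ⟨h, he⟩⟩ := eigen_mod_four (r := 1) hn u
    · simp only [h, he] at hq
      rcases eq_zero_or_of_mul_add_one (z := z) (by push_cast at hq; linarith) with hz | hz <;>
        rw [hz] at h
      · exact Or.inl ⟨he, Or.inl (by rw [h]; norm_num)⟩
      · exact Or.inl ⟨he, Or.inr (by rw [h]; norm_num)⟩
    · simp only [h, he] at hq
      rcases eq_zero_or_of_mul_sub_one (z := z) (by push_cast at hq; linarith) with hz | hz <;>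
        rw [hz] at h
      · exact Or.inr ⟨he, Or.inl (by rw [h]; norm_num)⟩
      · exact Or.inr ⟨he, Or.inr (by rw [h]; norm_num)⟩
  · intro v
    rw [hform]
    refine mul_nonneg (neg_natCast_le_eigen v) ?_
    obtain ⟨z, ⟨h, he⟩ | ⟨h, he⟩⟩ := eigen_mod_four (r := 1) hn v
    · simp only [h, he]
      have := mul_add_one_nonneg z
      push_cast; linarith
    · simp only [h, he]
      have := mul_sub_one_nonneg z
      push_cast; linarith
  · intro c hc
    rw [moment_combination, walkSum_zero_of_mem hc, walkSum_one_of_mem h3 hc,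
      walkSum_two_of_mem h3 hc, walkSum_three_of_mem h4 hc, ← hcard, eigen_zero, chi_zero_left]
    have h1 := walkSum_two_add_le h4 (c + 1)
    calc _ = 2 * ((n : ℝ) + 3) * C.card * (n * n - 3 * n +
          2 * (walkSum C 2 (c + 1) + n * walkSum C 1 (c + 1))) := by ring
      _ ≤ 2 * ((n : ℝ) + 3) * C.card * (n * n - 3 * n + 2 * n) := by gcongr
      _ = _ := by ring

theorem codeHat_support_doubly_shortened_extended {n a : ℕ} {C : Finset (Word n)}
    (h4 : Separated 4 C) (hn : n = 4 * a + 2) (hcard : 2 * ((n : ℝ) + 2) * C.card = 2 ^ n)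
    {u : Word n} (hS : codeHat C u ≠ 0) (hu : u ≠ 0) : u = 1 ∨ EigenIn 2 (-2) 0 0 u := by
  have h3 : Separated 3 C := h4.mono (by norm_num)
  -- The second factor is e² - 4 on even words and e² on odd words.
  have hform : ∀ v : Word n, (-2 * n) + (-2) * eigen v + n * eigen v ^ 2 + 1 * eigen v ^ 3 +
      chi v 1 * ((-2 * n) + (-2) * eigen v + 0 * eigen v ^ 2) =
      (eigen v + n) * (eigen v ^ 2 - 2 - 2 * chi v 1) := fun v => by ring
  have hq := eq_zero_of_codeHat_ne_zero (C := C) (q := fun v => (-2 * n) + (-2) * eigen v +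
    n * eigen v ^ 2 + 1 * eigen v ^ 3 + chi v 1 * ((-2 * n) + (-2) * eigen v + 0 * eigen v ^ 2))
    ?_ ?_ hu hS
  · simp only [hform] at hq
    rcases mul_eq_zero.mp hq with hq | hq
    · exact Or.inl (eq_one_of_eigen (by linarith))
    right
    obtain ⟨z, ⟨h, he⟩ | ⟨h, he⟩⟩ := eigen_mod_four (r := 2) hn u
    · simp only [h, he] at hq
      rcases eq_zero_or_of_mul_add_one (z := z) (by push_cast at hq; linarith) with hz | hz <;>
        rw [hz] at h
      · exact Or.inl ⟨he, Or.inl (by rw [h]; norm_num)⟩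
      · exact Or.inl ⟨he, Or.inr (by rw [h]; norm_num)⟩
    · simp only [h, he] at hq
      have hz : (z : ℝ) = 0 := pow_eq_zero_iff (two_ne_zero) |>.mp (by push_cast at hq; linarith)
      rw [hz] at h
      exact Or.inr ⟨he, Or.inl (by rw [h]; norm_num)⟩
  · intro v
    rw [hform]
    refine mul_nonneg (neg_natCast_le_eigen v) ?_
    obtain ⟨z, ⟨h, he⟩ | ⟨h, he⟩⟩ := eigen_mod_four (r := 2) hn v
    · simp only [h, he]
      have := mul_add_one_nonneg z
      push_cast; linarith
    · simp only [h, he]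
      have := sq_nonneg (z : ℝ)
      push_cast; linarith
  · intro c hc
    rw [moment_combination, walkSum_zero_of_mem hc, walkSum_one_of_mem h3 hc,
      walkSum_two_of_mem h3 hc, walkSum_three_of_mem h4 hc, ← hcard, eigen_zero, chi_zero_left]
    have h1 := walkSum_zero_nonneg C (c + 1)
    have h2 : 0 ≤ walkSum C 1 (c + 1) := by rw [walkSum_one_eq_card]; positivity
    have h3 : 0 ≤ 2 * n * walkSum C 0 (c + 1) + 2 * walkSum C 1 (c + 1) := by positivity
    calc _ = 2 * ((n : ℝ) + 2) * C.card * (n * n - 2 * n -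
          (2 * n * walkSum C 0 (c + 1) + 2 * walkSum C 1 (c + 1))) := by ring
      _ ≤ 2 * ((n : ℝ) + 2) * C.card * (n * n - 2 * n - 0) := by gcongr
      _ = _ := by ring

/-! ### Common parity of the codewords at distance 4 -/

lemma moment_eq_add {n : ℕ} (hn : n ≠ 0) (C : Finset (Word n)) (x : Word n) {q : Word n → ℝ}
    (hq : ∀ u, codeHat C u ≠ 0 → u ≠ 0 → u ≠ 1 → q u = 0) :
    moment C x q = C.card * q 0 + codeHat C 1 * chi 1 x * q 1 := by
  have h01 : (0 : Word n) ≠ 1 := fun h => by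
    have := congrFun h ⟨0, Nat.pos_of_ne_zero hn⟩
    simp at this
  have h : ∀ u ∉ ({0, 1} : Finset (Word n)), codeHat C u * chi u x * q u = 0 := fun u hu => by
    simp only [mem_insert, mem_singleton, not_or] at hu
    by_cases h0 : codeHat C u = 0
    · simp [h0]
    · simp [hq u h0 hu.1 hu.2]
  rw [moment, ← sum_subset (subset_univ {0, 1}) fun u _ hu => h u hu, sum_pair h01]
  simp

lemma chi_one_one {n : ℕ} : chi (1 : Word n) 1 = (-1) ^ n := by
  simp [chi]

theorem evenDistances_doubly_shortened_extended {n a : ℕ} {C : Finset (Word n)}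
    (h4 : Separated 4 C) (hn : n = 4 * a + 2) (ha : a ≠ 0)
    (hcard : 2 * ((n : ℝ) + 2) * C.card = 2 ^ n) : EvenDistances C := by
  have h3 : Separated 3 C := h4.mono (by norm_num)
  -- The case n = 2 must be avoided, since n² - 4 is cancelled below.
  have hn6 : (6 : ℝ) ≤ n := by exact_mod_cast (by omega : 6 ≤ n)
  have key : ∀ x ∈ C, codeHat C 1 * chi 1 x = C.card := fun x hx => by
    -- e³ - 4e vanishes at 2, -2 and 0, and its moment at a codeword is 0.
    have h1 := moment_eq_add (by omega) C x (q := fun v => 0 + (-4) * eigen v + 0 * eigen v ^ 2 +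
      1 * eigen v ^ 3 + chi v 1 * (0 + 0 * eigen v + 0 * eigen v ^ 2)) fun u hS h0 h1 => by
        rcases (codeHat_support_doubly_shortened_extended h4 hn hcard hS h0).resolve_left h1 with
          ⟨_, h | h⟩ | ⟨_, h | h⟩ <;> simp only [h] <;> ring
    rw [moment_combination, walkSum_one_of_mem h3 hx, walkSum_three_of_mem h4 hx, eigen_zero,
      eigen_one] at h1
    have h2 : ((C.card : ℝ) - codeHat C 1 * chi 1 x) * (n * (n ^ 2 - 4)) = 0 := by linarith
    have h5 : (n : ℝ) * (n ^ 2 - 4) ≠ 0 := by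
      have : 0 < (n : ℝ) * (n ^ 2 - 4) := mul_pos (by linarith) (by nlinarith)
      exact this.ne'
    linarith [(mul_eq_zero.mp h2).resolve_right h5]
  intro x hx y hy
  have hpos : (0 : ℝ) < C.card := by exact_mod_cast card_pos.mpr ⟨x, hx⟩
  have h0 : codeHat C 1 ≠ 0 := fun h0 => by
    have := key x hx
    rw [h0, zero_mul] at this
    linarith
  exact mul_left_cancel₀ h0 ((key x hx).trans (key y hy).symm)

lemma chi_one_eq_of_mul_pos {n : ℕ} {s : ℝ} {x y : Word n} (hx : 0 < s * chi 1 x)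
    (hy : 0 < s * chi 1 y) : chi 1 x = chi 1 y := by
  rcases chi_eq_one_or 1 x with h | h <;> rcases chi_eq_one_or 1 y with h' | h' <;>
    rw [h] at hx ⊢ <;> rw [h'] at hy ⊢ <;> linarith

/-- The distance 4 has to be attained: two words at distance 5 are also separated, but have opposite
parities. -/
lemma evenDistances_of_card_eq_two {n : ℕ} {C : Finset (Word n)} (hmin : HasMinDist C 4)
    (hcard : C.card = 2) : EvenDistances C := by
  obtain ⟨x, hx, y, hy, hne, hd⟩ := hmin.1
  have hC : {x, y} = C := eq_of_subset_of_card_le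
    (insert_subset hx (singleton_subset_iff.mpr hy)) (by rw [hcard, card_pair hne])
  have hxy : chi 1 x = chi 1 y := by rw [chi_one_eq_mul x y, hd]; norm_num
  intro u hu v hv
  simp only [← hC, mem_insert, mem_singleton] at hu hv
  rcases hu with rfl | rfl <;> rcases hv with rfl | rfl <;> simp [hxy]

theorem evenDistances_triply_shortened_extended {n a : ℕ} {C : Finset (Word n)}
    (hmin : HasMinDist C 4) (h4 : Separated 4 C) (hn : n = 4 * a + 1) (ha : a ≠ 0)
    (hcard : 2 * ((n : ℝ) + 3) * C.card = 2 ^ n) : EvenDistances C := by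
  have h3 : Separated 3 C := h4.mono (by norm_num)
  -- The estimate below needs (n - 1)(n - 2) > 12, which is an equality at n = 5.
  by_cases ha1 : a = 1
  · subst ha1
    obtain rfl : n = 5 := hn
    refine evenDistances_of_card_eq_two hmin ?_
    have : (C.card : ℝ) = 2 := by norm_num at hcard; linarith
    exact_mod_cast this
  have hn9 : (9 : ℝ) ≤ n := by exact_mod_cast (by omega : 9 ≤ n)
  have key : ∀ x ∈ C, 0 < codeHat C 1 * chi 1 x := fun x hx => by
    -- e³ - 7e + 6 = (e - 1)(e - 2)(e + 3) handles even words, e³ - 7e - 6 = (e + 1)(e + 2)(e - 3)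
    -- odd ones.
    have h1 := moment_eq_add (by omega) C x (q := fun v => 0 + (-7) * eigen v + 0 * eigen v ^ 2 +
      1 * eigen v ^ 3 + chi v 1 * (6 + 0 * eigen v + 0 * eigen v ^ 2)) fun u hS h0 h1 => by
        rcases (codeHat_support_triply_shortened_extended h4 hn hcard hS h0).resolve_left h1 with
          ⟨h', h | h⟩ | ⟨h', h | h⟩ <;> simp only [h, h'] <;> ring
    have hodd : Odd n := ⟨2 * a, by omega⟩
    rw [moment_combination, walkSum_one_of_mem h3 hx, walkSum_three_of_mem h4 hx, eigen_zero,
      eigen_one, chi_one_one, hodd.neg_one_pow, chi_zero_left, ← hcard] at h1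
    have h2 : ((n : ℝ) + 3) * (((n : ℝ) - 1) * (n - 2) * (C.card - codeHat C 1 * chi 1 x)) =
        (n + 3) * (12 * C.card * walkSum C 0 (x + 1)) := by linarith
    have h5 := mul_left_cancel₀ (by positivity) h2
    have h6 := walkSum_zero_le_one C (x + 1)
    have hpos : (0 : ℝ) < C.card := by exact_mod_cast card_pos.mpr ⟨x, hx⟩
    have h7 : 12 * (C.card : ℝ) * walkSum C 0 (x + 1) ≤ 12 * C.card * 1 := by gcongr
    have h8 : (12 : ℝ) < (n - 1) * (n - 2) := by nlinarith
    by_contra hneg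
    push Not at hneg
    nlinarith
  exact fun x hx y hy => chi_one_eq_of_mul_pos (key x hx) (key y hy)

/-! ### Interpolation and the four families -/

lemma exists_quadratic_interpolation (φ : ℝ → ℝ) (s : ℝ) : ∃ a b c : ℝ, ∀ y : ℝ,
    (y = s ∨ y = s + 2 ∨ y = s - 2) → φ y = a + b * y + c * y ^ 2 := by
  set b := (φ (s + 2) - φ (s - 2)) / 4 with hb
  set c := (φ (s + 2) - 2 * φ s + φ (s - 2)) / 8 with hc
  refine ⟨φ s - b * s + c * s ^ 2, b - 2 * c * s, c, ?_⟩
  rintro y (rfl | rfl | rfl) <;> rw [hb, hc] <;> ring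

lemma exists_cubic_interpolation (φ : ℝ → ℝ) : ∃ a b c d : ℝ, ∀ y : ℝ,
    (y = 1 ∨ y = -3 ∨ y = -1 ∨ y = 3) → φ y = a + b * y + c * y ^ 2 + d * y ^ 3 := by
  set c := (φ 3 + φ (-3) - φ 1 - φ (-1)) / 16 with hc
  set d := ((φ 3 - φ (-3)) / 3 - (φ 1 - φ (-1))) / 16 with hd
  refine ⟨(φ 1 + φ (-1)) / 2 - c, (φ 1 - φ (-1)) / 2 - d, c, d, ?_⟩
  rintro y (rfl | rfl | rfl | rfl) <;> rw [hc, hd] <;> ring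

lemma Separated.of_hasMinDist {n d : ℕ} {C : Finset (Word n)} (h : HasMinDist C d) :
    Separated d C := fun x hx y hy hne => h.2 ⟨x, hx, y, hy, hne, rfl⟩

lemma nonempty_of_hasMinDist {n d : ℕ} {C : Finset (Word n)} (h : HasMinDist C d) : C.Nonempty :=
  let ⟨x, hx, _⟩ := h.1; ⟨x, hx⟩

lemma two_pow_eq_four_mul {m : ℕ} (hm : 2 ≤ m) : ∃ b, 1 ≤ b ∧ 2 ^ m = 4 * b ∧ (m ≠ 2 → 2 ≤ b) := by
  obtain ⟨k, rfl⟩ := Nat.exists_eq_add_of_le hm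
  refine ⟨2 ^ k, Nat.one_le_two_pow, by rw [pow_add]; norm_num, fun h => ?_⟩
  exact Nat.le_self_pow (n := k) (by omega) 2

lemma cast_card_eq {n m t : ℕ} {C : Finset (Word n)} (hn : t = 2 ^ m) (hm : m ≤ n)
    (hC : C.card = 2 ^ (n - m)) : (t : ℝ) * C.card = 2 ^ n := by
  rw [hn, hC]; push_cast
  rw [← pow_add, Nat.add_sub_cancel' hm]

/-- The four eigenvalues 0, -4, 2, -2 would call for a cubic, and at distance 3 the walks of length
3 from a codeword also reach the codewords at distance 3. -/
theorem completelySemiregular_of_hasParams3_three {n : ℕ} {C : Finset (Word n)}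
    (h : HasParams3 3 C) : CompletelySemiregular C := by
  obtain ⟨m, hnm, hm, hcard, hmin⟩ := h
  have h3 := Separated.of_hasMinDist hmin
  have hm2 : 2 ≤ m := by
    by_contra hlt
    have : m = 0 ∨ m = 1 := by omega
    rcases this with rfl | rfl <;> omega
  obtain ⟨b, hb, hb', -⟩ := two_pow_eq_four_mul hm2
  have hM : ((n : ℝ) + 4) * C.card = 2 ^ n := by
    rw [← cast_card_eq hnm hm hcard]; push_cast; ring
  exact completelySemiregular_of_supportedOn (nonempty_of_hasMinDist hmin) h3 fun u hS hu =>
    Or.inr (codeHat_support_triply_shortened h3 (a := b - 1) (by omega) hM hS hu)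

theorem regular_of_hasParams3_two {n : ℕ} {C : Finset (Word n)} (h : HasParams3 2 C) :
    CompletelySemiregular C ∧ DistanceInvariant C := by
  obtain ⟨m, hnm, hm, hcard, hmin⟩ := h
  have h3 := Separated.of_hasMinDist hmin
  have hm2 : 2 ≤ m := by
    by_contra hlt
    have : m = 0 ∨ m = 1 := by omega
    rcases this with rfl | rfl <;> omega
  obtain ⟨b, hb, hb', -⟩ := two_pow_eq_four_mul hm2
  have hM : ((n : ℝ) + 3) * C.card = 2 ^ n := by
    rw [← cast_card_eq hnm hm hcard]; push_cast; ring
  have hS : SupportedOn C (EigenIn 1 (-3) (-1) (-1)) := fun u hS hu =>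
    Or.inr (codeHat_support_doubly_shortened h3 (a := b - 1) (by omega) hM hS hu)
  refine ⟨completelySemiregular_of_supportedOn (nonempty_of_hasMinDist hmin) h3 hS,
    distanceInvariant_of_supportedOn h3 hS fun φ => ?_⟩
  obtain ⟨a, b, c, hφ⟩ := exists_quadratic_interpolation φ (-1)
  refine ⟨a, b, c, 0, Or.inl rfl, fun u hu => ?_⟩
  rw [hφ (eigen u), zero_mul, add_zero]
  rcases hu with ⟨-, hu | hu⟩ | ⟨-, hu | hu⟩ <;> rw [hu] <;> norm_num

theorem regular_of_hasParams4_three {n : ℕ} {C : Finset (Word n)} (h : HasParams4 3 C) :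
    CompletelySemiregular C ∧ DistanceInvariant C := by
  obtain ⟨m, hnm, hm, hcard, hmin⟩ := h
  have h4 := Separated.of_hasMinDist hmin
  have h3 : Separated 3 C := h4.mono (by norm_num)
  -- m = 2 would give n = 1, against m + 1 ≤ n.
  have hm3 : 3 ≤ m := by
    by_contra hlt
    have : m = 0 ∨ m = 1 ∨ m = 2 := by omega
    rcases this with rfl | rfl | rfl <;> omega
  obtain ⟨b, hb, hb', hb2⟩ := two_pow_eq_four_mul (m := m) (by omega)
  replace hb2 := hb2 (by omega)
  have hM : 2 * ((n : ℝ) + 3) * C.card = 2 ^ n := by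
    rw [← cast_card_eq (t := 2 * (n + 3)) (by rw [hnm, pow_succ, mul_comm]) hm hcard]
    push_cast; ring
  have hn : n = 4 * (b - 1) + 1 := by omega
  have he := evenDistances_triply_shortened_extended hmin h4 hn (by omega) hM
  have hS : SupportedOn C (EigenIn 1 (-3) (-1) 3) := fun u hS hu =>
    (codeHat_support_triply_shortened_extended h4 hn hM hS hu).imp_left fun h => ⟨h, he⟩
  refine ⟨completelySemiregular_of_supportedOn (nonempty_of_hasMinDist hmin) h3 hS,
    distanceInvariant_of_supportedOn h3 hS fun φ => ?_⟩
  obtain ⟨a, b, c, d, hφ⟩ := exists_cubic_interpolation φ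
  refine ⟨a, b, c, d, Or.inr h4, fun u hu => hφ _ ?_⟩
  rcases hu with ⟨-, hu | hu⟩ | ⟨-, hu | hu⟩ <;> simp [hu]

theorem regular_of_hasParams4_two {n : ℕ} {C : Finset (Word n)} (h : HasParams4 2 C) :
    CompletelySemiregular C ∧ DistanceInvariant C := by
  obtain ⟨m, hnm, hm, hcard, hmin⟩ := h
  have h4 := Separated.of_hasMinDist hmin
  have h3 : Separated 3 C := h4.mono (by norm_num)
  -- m = 2 would give n = 2, against m + 1 ≤ n.
  have hm3 : 3 ≤ m := by
    by_contra hlt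
    have : m = 0 ∨ m = 1 ∨ m = 2 := by omega
    rcases this with rfl | rfl | rfl <;> omega
  obtain ⟨b, hb, hb', hb2⟩ := two_pow_eq_four_mul (m := m) (by omega)
  replace hb2 := hb2 (by omega)
  have hM : 2 * ((n : ℝ) + 2) * C.card = 2 ^ n := by
    rw [← cast_card_eq (t := 2 * (n + 2)) (by rw [hnm, pow_succ, mul_comm]) hm hcard]
    push_cast; ring
  have hn : n = 4 * (b - 1) + 2 := by omega
  have he := evenDistances_doubly_shortened_extended h4 hn (by omega) hM
  have hS : SupportedOn C (EigenIn 2 (-2) 0 0) := fun u hS hu =>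
    (codeHat_support_doubly_shortened_extended h4 hn hM hS hu).imp_left fun h => ⟨h, he⟩
  refine ⟨completelySemiregular_of_supportedOn (nonempty_of_hasMinDist hmin) h3 hS,
    distanceInvariant_of_supportedOn h3 hS fun φ => ?_⟩
  obtain ⟨a, b, c, hφ⟩ := exists_quadratic_interpolation φ 0
  refine ⟨a, b, c, 0, Or.inl rfl, fun u hu => ?_⟩
  rw [hφ (eigen u), zero_mul, add_zero]
  rcases hu with ⟨-, hu | hu⟩ | ⟨-, hu | hu⟩ <;> rw [hu] <;> norm_num

/-! ### Self-complementary codes -/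

lemma distToCode_add_one {n : ℕ} {C : Finset (Word n)} (hC : SelfComplementary C) (x : Word n) :
    distToCode (x + 1) C = distToCode x C := by
  have hmem : ∀ c ∈ C, c + 1 ∈ C := fun c hc => by
    rw [SelfComplementary] at hC
    rw [← hC]; exact mem_image_of_mem _ hc
  have hd : ∀ c : Word n, hammingDist (x + 1) (c + 1) = hammingDist x c := fun c => by
    simp [hammingDist]
  refine le_antisymm ?_ ?_
  · exact le_iInf₂ fun c hc => hd c ▸ iInf₂_le (c + 1) (hmem c hc)
  · refine le_iInf₂ fun c hc => ?_
    have h1 := hd (c + 1)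
    rw [add_add_cancel_word] at h1
    exact h1 ▸ iInf₂_le (c + 1) (hmem c hc)

theorem completelyRegular_of_selfComplementary {n : ℕ} {C : Finset (Word n)}
    (h : CompletelySemiregular C) (hC : SelfComplementary C) : CompletelyRegular C :=
  fun x y hxy => h x y hxy (by rw [distToCode_add_one hC, distToCode_add_one hC, hxy])

end CubeCode

theorem mainTheorem3 (n : ℕ) (C : Finset (Word n)) :
    (HasParams3 3 C → CompletelySemiregular C) ∧
    (HasParams4 3 C → CompletelySemiregular C ∧ DistanceInvariant C) ∧
    (HasParams3 2 C → CompletelySemiregular C ∧ DistanceInvariant C) ∧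
    (HasParams4 2 C → CompletelySemiregular C ∧ DistanceInvariant C) ∧
    (HasParams3 3 C → SelfComplementary C → CompletelyRegular C) := by
  exact ⟨CubeCode.completelySemiregular_of_hasParams3_three,
    CubeCode.regular_of_hasParams4_three, CubeCode.regular_of_hasParams3_two,
    CubeCode.regular_of_hasParams4_two, fun h hC =>
    CubeCode.completelyRegular_of_selfComplementary
      (CubeCode.completelySemiregular_of_hasParams3_three h) hC⟩
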